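/- **Model.** For $d\ge 1$, a symmetric convex body $A\subset\mathbb R^d$ (a nonempty compact convex set with $A=-A$) and a nonempty finite set $S\subset\mathbb R^d$ of $n$ points, consider a random access machine with real registers which is given the proximity parameter $\epsilon$ and the dimension $d$, and which has access to $S$ and $A$ only as follows: it may draw independent uniformly random points of $S$ into a work list, empty the work list, and, when the work list holds $m\le d+1$ points, ask whether these points lie in one translate $v+A$ ($v\in\mathbb R^d$) of $A$. Arithmetic ($+,-,\times$, natural number constants) and comparisons of real registers, jumps, emptying the work list and drawing a point cost one unit of time each; a containment query on $m$ points costs $1+m$ units. **Theorem.** There are an absolute constant $C$ and a single program for this machine such that, for all $d\ge 1$, every symmetric convex body $A\subset\mathbb R^d$, every $0<\epsilon\le 1$ and every set $S$ of $n\ge 1$ points in $\mathbb R^d$: 1. for every outcome of the random draws, the program stops with the answer "accept" or "reject" after sampling at most $C\,d/\epsilon^{d+1}$ points and after running time at most $C\,d/\epsilon^{d+1}$; 2. if all points of $S$ lie in one translate of $A$, then the program always accepts (for every outcome of the random draws); 3. if every translate of $A$ contains at most $(1-\epsilon)n$ points of $S$, then the program rejects with probability at least $2/3$. -/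

import Mathlib

open scoped Pointwise

noncomputable section

namespace ClusterTesting

/-- The space `ℝ^d`. -/
abbrev Space (d : ℕ) : Type := EuclideanSpace ℝ (Fin d)

/-- The set `T` is contained in some translated copy `v + A` of `A`. -/
def FitsInTranslate {d : ℕ} (A T : Set (Space d)) : Prop :=
  ∃ v : Space d, T ⊆ v +ᵥ A

open Classical in
/-- The number of points of the finite set `S` that lie in `v + A`. -/
def countInTranslate {d : ℕ} (A : Set (Space d)) (S : Finset (Space d)) (v : Space d) : ℕ :=
  (S.filter (fun x => x ∈ v +ᵥ A)).card

/-! ### The machine model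

A program is a finite list of instructions, executed by a real random access machine that has
real registers `R 0, R 1, …` and a work list `W` of sampled points.  The points are opaque to the
machine: it draws them at random from the input set, and it learns about them only by asking
whether the at most `d + 1` points in `W` fit into one translate of the body. -/

/-- Instructions. Labels are positions in the program. -/
inductive Instr : Type
  /-- `R i := c`, for a natural number `c`. -/
  | const (i c : ℕ)
  /-- `R i := R j + R k`. -/
  | add (i j k : ℕ)
  /-- `R i := R j - R k`. -/
  | sub (i j k : ℕ)
  /-- `R i := R j * R k`. -/
  | mul (i j k : ℕ)
  /-- If `R i ≤ R j`, go to `l`. -/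
  | jumpLe (i j l : ℕ)
  /-- Draw a fresh uniformly random point of the input set and add it to `W`. -/
  | sample
  /-- Empty the work list `W`. -/
  | clear
  /-- If the points of `W` fit into one translate of the body, go to `l`. Available only while
  `W` has at most `d + 1` entries. -/
  | jumpFit (l : ℕ)
  /-- Stop and accept. -/
  | accept
  /-- Stop and reject. -/
  | reject

/-- Programs. -/
abbrev Program : Type := List Instr

/-- Answers of the machine. -/
inductive Verdict : Type
  | accept
  | reject

/-- A configuration of the machine, with the two resources used so far. -/
structure Config (d : ℕ) where
  /-- position of the next instruction -/
  pc : ℕ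
  /-- contents of the real registers -/
  reg : ℕ → ℝ
  /-- the work list -/
  work : List (Space d)
  /-- the answer, once the machine has stopped -/
  verdict : Option Verdict
  /-- number of points sampled so far -/
  samples : ℕ
  /-- running time so far -/
  time : ℕ

/-- The initial configuration: `R 0` holds the proximity parameter, `R 1` the dimension, and all
other registers hold `0`. -/
def initial (d : ℕ) (ε : ℝ) : Config d where
  pc := 0
  reg := fun i => if i = 0 then ε else if i = 1 then (d : ℝ) else 0
  work := []
  verdict := none
  samples := 0
  time := 0

open Classical in
/-- One instruction. Here `ω` is the sequence of random points of `S`, consumed in order.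
Every instruction costs `1`, and a containment test costs `1` plus the number of points tested.
A machine that leaves its program, or tests more than `d + 1` points at once, hangs forever. -/
def step {d : ℕ} (P : Program) (A : Set (Space d)) {S : Finset (Space d)} (ω : ℕ → S)
    (c : Config d) : Config d :=
  match c.verdict with
  | some _ => c
  | none =>
    match P[c.pc]? with
    | none => { c with time := c.time + 1 }
    | some (.const i a) =>
      { c with pc := c.pc + 1, reg := Function.update c.reg i (a : ℝ), time := c.time + 1 }
    | some (.add i j k) =>
      { c with
        pc := c.pc + 1
        reg := Function.update c.reg i (c.reg j + c.reg k)
        time := c.time + 1 }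
    | some (.sub i j k) =>
      { c with
        pc := c.pc + 1
        reg := Function.update c.reg i (c.reg j - c.reg k)
        time := c.time + 1 }
    | some (.mul i j k) =>
      { c with
        pc := c.pc + 1
        reg := Function.update c.reg i (c.reg j * c.reg k)
        time := c.time + 1 }
    | some (.jumpLe i j l) =>
      { c with pc := if c.reg i ≤ c.reg j then l else c.pc + 1, time := c.time + 1 }
    | some .sample =>
      { c with
        pc := c.pc + 1
        work := (ω c.samples : Space d) :: c.work
        samples := c.samples + 1
        time := c.time + 1 }
    | some .clear => { c with pc := c.pc + 1, work := [], time := c.time + 1 }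
    | some (.jumpFit l) =>
      if c.work.length ≤ d + 1 then
        { c with
          pc := if FitsInTranslate A {x | x ∈ c.work} then l else c.pc + 1
          time := c.time + 1 + c.work.length }
      else { c with time := c.time + 1 }
    | some .accept => { c with verdict := some .accept, time := c.time + 1 }
    | some .reject => { c with verdict := some .reject, time := c.time + 1 }

/-- The configuration after `t` instructions, on proximity parameter `ε` and random points `ω`. -/
def run {d : ℕ} (P : Program) (A : Set (Space d)) {S : Finset (Space d)} (ε : ℝ) (ω : ℕ → S)
    (t : ℕ) : Config d :=
  (step P A ω)^[t] (initial d ε)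

/-- On the random points `ω`, the program stops with the answer `v`, having sampled `q` points in
total and with total running time `T`. -/
def HaltsWith {d : ℕ} (P : Program) (A : Set (Space d)) {S : Finset (Space d)} (ε : ℝ)
    (ω : ℕ → S) (v : Verdict) (q T : ℕ) : Prop :=
  ∃ t : ℕ, (run P A ε ω t).verdict = some v ∧ (run P A ε ω t).samples = q ∧
    (run P A ε ω t).time = T

/-- On the random points `ω`, the program stops with the answer `v`. -/
def Answers {d : ℕ} (P : Program) (A : Set (Space d)) {S : Finset (Space d)} (ε : ℝ)
    (ω : ℕ → S) (v : Verdict) : Prop :=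
  ∃ q T : ℕ, HaltsWith P A ε ω v q T

/-- The law of a sequence of independent uniformly random points of the nonempty finite set `S`. -/
def sampleLaw {d : ℕ} (S : Finset (Space d)) [Nonempty S] : MeasureTheory.Measure (ℕ → S) :=
  MeasureTheory.Measure.infinitePi (fun _ : ℕ => (PMF.uniformOfFintype S).toMeasure)

end ClusterTesting

end

namespace ClusterTesting

/-! Since `A` is symmetric, `v ∈ x + A` iff `x ∈ v + A`; so points fit into one translate iff the
translates of `A` centred at them have a common point. If no point lies in more than `(1 - ε) n` of
these convex sets, the optimal fractional Helly theorem yields at least `(ε n) ^ (d + 1)` ordered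
`(d + 1)`-tuples that do not fit (`pow_le_card_bad_tuples`). A random tuple is then a witness with
probability at least `ε ^ (d + 1)`, and `⌈2 / ε ^ (d + 1)⌉` independent rounds all miss with
probability at most `1 / 3`. An input that fits has no witness, hence is never rejected.

`fractional_helly` rests on the upper bound theorem for nerves of convex sets. Generic thickening
keeps the nerve and makes the lowest point of each intersection determined by a unique basis of at
most `d` sets (`exists_nondegenerate`). A face of size `d + 1` is charged to the `d`-face left after
deleting its last non-basis element (`exists_extension`). The `d`-faces with more than `j` possible
extensions, paired with the complement of face and extensions, form a skew Bollobás system (`skew`),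
so there are at most `(n - 1 - j).choose d` of them (`card_le_choose_of_skew`). Summing over `j`
bounds the faces from above, hence the nonfaces from below. -/

/-! ### Homogeneous polynomials and the skew set pair inequality. -/

/-- Functions on `ℝ^ι` given by homogeneous polynomials of degree `b`. -/
def homogeneousFunctions (ι : Type*) (b : ℕ) : Submodule ℝ ((ι → ℝ) → ℝ) :=
  Submodule.span ℝ (Set.range fun (s : Sym ι b) (w : ι → ℝ) => ((s : Multiset ι).map w).prod)

theorem coordinate_mul_mem {ι : Type*} {b : ℕ} (i : ι) {f : (ι → ℝ) → ℝ}
    (hf : f ∈ homogeneousFunctions ι b) :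
    (fun w => w i * f w) ∈ homogeneousFunctions ι (b + 1) := by
  induction hf using Submodule.span_induction with
  | mem f hf =>
    obtain ⟨s, rfl⟩ := hf
    refine Submodule.subset_span ⟨i ::ₛ s, ?_⟩
    funext w
    change (((i ::ₛ s : Sym ι (b + 1)) : Multiset ι).map w).prod = _
    rw [Sym.coe_cons, Multiset.map_cons, Multiset.prod_cons]
  | zero =>
    convert (homogeneousFunctions ι (b + 1)).zero_mem using 1
    funext w
    simp
  | add f g _ _ hf hg =>
    convert (homogeneousFunctions ι (b + 1)).add_mem hf hg using 1
    funext w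
    simp [mul_add]
  | smul c f _ hf =>
    convert (homogeneousFunctions ι (b + 1)).smul_mem c hf using 1
    funext w
    simp [mul_left_comm]

theorem linear_mul_mem {ι : Type*} [Fintype ι] {b : ℕ} (a : ι → ℝ) {f : (ι → ℝ) → ℝ}
    (hf : f ∈ homogeneousFunctions ι b) :
    (fun w => (∑ i, w i * a i) * f w) ∈ homogeneousFunctions ι (b + 1) := by
  convert (homogeneousFunctions ι (b + 1)).sum_mem (t := Finset.univ)
    (fun i _ => (homogeneousFunctions ι (b + 1)).smul_mem (a i) (coordinate_mul_mem i hf)) using 1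
  funext w
  simp only [Finset.sum_apply, Pi.smul_apply, smul_eq_mul, Finset.sum_mul]
  exact Finset.sum_congr rfl fun i _ => by ring

theorem prod_linear_mem {ι V : Type*} [Fintype ι] (a : V → ι → ℝ) (C : Finset V) :
    (fun w => ∏ c ∈ C, ∑ i, w i * a c i) ∈ homogeneousFunctions ι C.card := by
  classical
  induction C using Finset.induction_on with
  | empty =>
    refine Submodule.subset_span ⟨Sym.nil, ?_⟩
    funext w
    simp
  | insert x C hx ih =>
    rw [Finset.card_insert_of_notMem hx]
    convert linear_mul_mem (a x) ih using 1
    funext w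
    rw [Finset.prod_insert hx]

theorem pow_coordinate_mul_mem {ι : Type*} {b : ℕ} (i : ι) {f : (ι → ℝ) → ℝ}
    (hf : f ∈ homogeneousFunctions ι b) (m : ℕ) :
    (fun w => w i ^ m * f w) ∈ homogeneousFunctions ι (b + m) := by
  induction m with
  | zero => simpa using hf
  | succ m ih =>
    have h : (fun w => w i ^ (m + 1) * f w) = fun w => w i * (w i ^ m * f w) := by
      funext w
      ring
    rw [h]
    exact coordinate_mul_mem i ih

theorem finrank_homogeneousFunctions_le (d b : ℕ) :
    Module.finrank ℝ (homogeneousFunctions (Fin (d + 1)) b) ≤ (d + b).choose d := by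
  refine (finrank_range_le_card (R := ℝ) _).trans ?_
  rw [Sym.card_sym_eq_choose, Fintype.card_fin]
  have h : d + 1 + b - 1 = d + b := by omega
  rw [h, Nat.choose_symm_add]

instance (d b : ℕ) : Module.Finite ℝ (homogeneousFunctions (Fin (d + 1)) b) :=
  Module.Finite.span_of_finite ℝ (Set.finite_range _)

open Polynomial in
theorem eval_prod_X_sub_C_eq_sum {V : Type*} (x : V → ℝ) (B : Finset V) (t : ℝ) :
    ∑ i : Fin (B.card + 1), (∏ y ∈ B, (X - C (x y))).coeff (i : ℕ) * t ^ (i : ℕ)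
      = ∏ y ∈ B, (t - x y) := by
  have hdeg : (∏ y ∈ B, (X - C (x y))).natDegree = B.card := by
    rw [natDegree_prod_of_monic _ _ fun y _ => monic_X_sub_C _]
    simp
  rw [Fin.sum_univ_eq_sum_range
    (fun i : ℕ => (∏ y ∈ B, (X - C (x y)) : ℝ[X]).coeff i * t ^ i) (B.card + 1),
    ← eval_eq_sum_range' (by omega), eval_prod]
  simp

/-- The skew version of Bollobás's set pair inequality. -/
theorem card_le_choose_of_skew {V α : Type*} [Fintype V] [LinearOrder α]
    (F : Finset (Finset V)) (D : Finset V → Finset V) (d b : ℕ) (ht : Finset V → α)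
    (hcard : ∀ B ∈ F, B.card = d) (hD : ∀ B ∈ F, (D B).card ≤ b)
    (hdisj : ∀ B ∈ F, Disjoint B (D B))
    (hskew : ∀ B ∈ F, ∀ B' ∈ F, B' ≠ B → Disjoint B' (D B) → ht B' < ht B) :
    F.card ≤ (d + b).choose d := by
  classical
  let x : V → ℝ := fun v => (Fintype.equivFin V v : ℕ)
  have hx : Function.Injective x := fun u v h => by
    exact (Fintype.equivFin V).injective (Fin.ext (Nat.cast_injective h))
  -- `B` becomes the monic polynomial with roots `x y`, `y ∈ B`, and `D B` the product of the
  -- evaluations at its points; the value of `P B` at `w B'` is nonzero iff `B'` and `D B` are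
  -- disjoint. The power of the leading coefficient, which is `1` on every `w B'`, pads the degree
  -- to exactly `b`.
  let w : Finset V → Fin (d + 1) → ℝ := fun B i =>
    (∏ y ∈ B, (Polynomial.X - Polynomial.C (x y))).coeff i
  let P : Finset V → (Fin (d + 1) → ℝ) → ℝ := fun B u =>
    u (Fin.last d) ^ (b - (D B).card) * ∏ c ∈ D B, ∑ i, u i * x c ^ (i : ℕ)
  have hP : ∀ B ∈ F, P B ∈ homogeneousFunctions (Fin (d + 1)) b := fun B hB => by
    have := pow_coordinate_mul_mem (Fin.last d)
      (prod_linear_mem (fun (c : V) (i : Fin (d + 1)) => x c ^ (i : ℕ)) (D B)) (b - (D B).card)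
    rwa [Nat.add_sub_cancel' (hD B hB)] at this
  have hval : ∀ B, ∀ B' ∈ F, P B (w B') = ∏ c ∈ D B, ∏ y ∈ B', (x c - x y) := fun B B' hB' => by
    have hlast : w B' (Fin.last d) = 1 := by
      have hm : (∏ y ∈ B', (Polynomial.X - Polynomial.C (x y))).Monic :=
        Polynomial.monic_prod_of_monic _ _ fun y _ => Polynomial.monic_X_sub_C _
      have hdeg : (∏ y ∈ B', (Polynomial.X - Polynomial.C (x y))).natDegree = d := by
        rw [Polynomial.natDegree_prod_of_monic _ _ fun y _ => Polynomial.monic_X_sub_C _]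
        simp [hcard B' hB']
      have := hm.coeff_natDegree
      rw [hdeg] at this
      simpa [w] using this
    simp only [P, hlast, one_pow, one_mul]
    refine Finset.prod_congr rfl fun c _ => ?_
    have := eval_prod_X_sub_C_eq_sum x B' (x c)
    rw [hcard B' hB'] at this
    exact this
  have hzero : ∀ B, ∀ B' ∈ F, ¬ Disjoint B' (D B) → P B (w B') = 0 := fun B B' hB' h => by
    obtain ⟨v, hv, hv'⟩ := Finset.not_disjoint_iff.1 h
    rw [hval B B' hB']
    exact Finset.prod_eq_zero hv' (Finset.prod_eq_zero hv (sub_self _))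
  have hne : ∀ B ∈ F, P B (w B) ≠ 0 := fun B hB => by
    rw [hval B B hB]
    refine Finset.prod_ne_zero_iff.2 fun c hc => Finset.prod_ne_zero_iff.2 fun y hy => ?_
    refine sub_ne_zero.2 fun h => ?_
    exact Finset.disjoint_left.1 (hdisj B hB) hy (hx h ▸ hc)
  have hli : LinearIndependent ℝ
      (fun B : F => (⟨P B, hP B B.2⟩ : homogeneousFunctions (Fin (d + 1)) b)) := by
    rw [Fintype.linearIndependent_iff]
    intro g hg
    by_contra! hex
    obtain ⟨B₁, hB₁⟩ := hex
    -- Evaluation at the highest set with nonzero coefficient kills every other term of the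
    -- relation, by skewness.
    obtain ⟨B₀, hB₀, hmax⟩ := (Finset.univ.filter fun B : F => g B ≠ 0).exists_max_image
      (fun B => ht B) ⟨B₁, by simpa using hB₁⟩
    have h0 := congrFun (congrArg Subtype.val hg) (w B₀)
    simp only [AddSubmonoidClass.coe_finsetSum, SetLike.val_smul, Finset.sum_apply,
      Pi.smul_apply, smul_eq_mul, ZeroMemClass.coe_zero, Pi.zero_apply] at h0
    rw [Finset.sum_eq_single B₀] at h0
    · have := (mul_eq_zero.1 h0).resolve_right (hne B₀ B₀.2)
      simp only [Finset.mem_filter] at hB₀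
      exact hB₀.2 this
    · intro B _ hBB
      by_cases hgB : g B = 0
      · simp [hgB]
      rw [hzero B B₀ B₀.2, mul_zero]
      intro hd
      have h1 := hskew B B.2 B₀ B₀.2 (fun h => hBB (Subtype.ext h.symm)) hd
      have h2 := hmax B (by simpa using hgB)
      exact absurd h1 (not_lt.2 h2)
    · simp
  have := hli.fintype_card_le_finrank
  rw [Fintype.card_coe] at this
  exact this.trans (finrank_homogeneousFunctions_le d b)

/-! ### Counting faces of nondegenerate families. -/

/-- Pascal's rule iterated `r` times. With `r = k - d` the sum is the bound on the faces, and the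
last term is what remains for the nonfaces. -/
theorem choose_succ_eq_sum_add (n d r : ℕ) (hr : r ≤ n) :
    n.choose (d + 1) =
      ∑ j ∈ Finset.range r, (n - 1 - j).choose d + (n - r).choose (d + 1) := by
  induction r with
  | zero => simp
  | succ r ih =>
    rw [ih (by omega), Finset.sum_range_succ]
    obtain ⟨m, hm⟩ : ∃ m, n - r = m + 1 := ⟨n - r - 1, by omega⟩
    have h1 : n - 1 - r = m := by omega
    have h2 : n - (r + 1) = m := by omega
    rw [hm, h1, h2, Nat.choose_succ_succ]
    ring

theorem sum_lt_sum_of_exchange {V : Type*} [DecidableEq V] (r : V → ℕ) {B B' : Finset V}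
    (hcard : B'.card = B.card) (hne : B' ≠ B)
    (hlt : ∀ x ∈ B' \ B, ∀ y ∈ B \ B', r y < r x) : ∑ v ∈ B, r v < ∑ v ∈ B', r v := by
  have hc : (B \ B').card = (B' \ B).card := Finset.card_sdiff_comm hcard.symm
  have hpos : (B \ B').Nonempty := by
    rw [Finset.sdiff_nonempty]
    exact fun h => hne (Finset.eq_of_subset_of_card_le h hcard.le).symm
  obtain ⟨y₀, hy₀, hmax⟩ := (B \ B').exists_max_image r hpos
  have h1 : ∑ v ∈ B \ B', r v ≤ (B \ B').card * r y₀ := by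
    simpa using Finset.sum_le_card_nsmul _ _ _ hmax
  have h2 : (B' \ B).card * (r y₀ + 1) ≤ ∑ v ∈ B' \ B, r v := by
    simpa using Finset.card_nsmul_le_sum (B' \ B) r (r y₀ + 1) fun x hx => hlt x hx y₀ hy₀
  have h3 := Finset.sum_inter_add_sum_sdiff B B' r
  have h4 := Finset.sum_inter_add_sum_sdiff B' B r
  rw [Finset.inter_comm] at h4
  have h5 := hpos.card_pos
  rw [← hc] at h2
  nlinarith

/-- The sets of a family indexed by `G` have a common point. -/
def IsFace {V X : Type*} (K : V → Set X) (G : Finset V) : Prop := ∃ x, ∀ v ∈ G, x ∈ K v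

theorem IsFace.mono {V X : Type*} {K : V → Set X} {G G' : Finset V} (h : IsFace K G')
    (hG : G ⊆ G') : IsFace K G :=
  h.imp fun _ hx v hv => hx v (hG hv)

/-- Every common intersection of the family `K` has a unique lowest point with respect to the height
`h`, and each lowest point is determined by a unique smallest subfamily, of at most `d` sets. -/
structure IsNondegenerate {V X : Type*} (K : V → Set X) (h : X → ℝ) (d : ℕ)
    (p : Finset V → X) (β : Finset V → Finset V) : Prop where
  mem : ∀ {G}, IsFace K G → ∀ v ∈ G, p G ∈ K v
  le : ∀ {G}, IsFace K G → ∀ x, (∀ v ∈ G, x ∈ K v) → h (p G) ≤ h x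
  unique : ∀ {G}, IsFace K G → ∀ x, (∀ v ∈ G, x ∈ K v) → h x ≤ h (p G) → x = p G
  basis_subset : ∀ {G}, IsFace K G → β G ⊆ G
  card_basis : ∀ {G}, IsFace K G → (β G).card ≤ d
  point_basis : ∀ {G}, IsFace K G → p (β G) = p G
  basis_minimal : ∀ {G T}, IsFace K G → IsFace K T → p T = p G → β G ⊆ T

namespace IsNondegenerate

variable {V X : Type*} {K : V → Set X} {h : X → ℝ} {d : ℕ} {p : Finset V → X}
  {β : Finset V → Finset V}

/-- The intersection over `B` lies between those over `G` and `β G`, whose lowest points agree. -/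
theorem point_eq (H : IsNondegenerate K h d p β) {G B : Finset V} (hG : IsFace K G)
    (h1 : β G ⊆ B) (h2 : B ⊆ G) : p B = p G := by
  have hB := hG.mono h2
  refine (H.unique hB (p G) (fun v hv => H.mem hG v (h2 hv)) ?_).symm
  rw [← H.point_basis hG]
  exact H.le (hG.mono (H.basis_subset hG)) _ fun v hv => H.mem hB v (h1 hv)

theorem basis_eq (H : IsNondegenerate K h d p β) {G B : Finset V} (hG : IsFace K G)
    (hB : IsFace K B) (hp : p B = p G) : β B = β G := by
  apply Finset.Subset.antisymm
  · exact H.basis_minimal hB (hG.mono (H.basis_subset hG)) ((H.point_basis hG).trans hp.symm)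
  · exact H.basis_minimal hG (hB.mono (H.basis_subset hB)) ((H.point_basis hB).trans hp)

open Classical in
/-- The elements that extend `B` to a set with the same lowest point, and come after all elements of
`B` outside the basis. -/
noncomputable def extension {V X : Type*} [Fintype V] (K : V → Set X) (p : Finset V → X)
    (β : Finset V → Finset V) (r : V → ℕ) (B : Finset V) : Finset V :=
  Finset.univ.filter fun x => x ∉ B ∧ p B ∈ K x ∧ ∀ y ∈ B, y ∉ β B → r y < r x

variable [Fintype V]

open Classical in
-- The point `p B` lies in all sets of `B'`, so the height cannot increase. If it stays equal, the
-- lowest points coincide and `β B ⊆ B'`; then `B'` trades non-basis elements of `B` for later ones,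
-- which raises the rank sum.
theorem skew (H : IsNondegenerate K h d p β) (r : V → ℕ) {B B' : Finset V} (hB : IsFace K B)
    (hcard : B'.card = B.card) (hne : B' ≠ B) (hsub : B' ⊆ B ∪ extension K p β r B) :
    toLex (h (p B'), -(∑ v ∈ B', r v : ℤ)) < toLex (h (p B), -(∑ v ∈ B, r v : ℤ)) := by
  have hpB : ∀ v ∈ B', p B ∈ K v := fun v hv => by
    rcases Finset.mem_union.1 (hsub hv) with hv | hv
    · exact H.mem hB v hv
    · exact ((Finset.mem_filter.1 hv).2).2.1
  have hB' : IsFace K B' := ⟨_, hpB⟩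
  rw [Prod.Lex.toLex_lt_toLex]
  rcases (H.le hB' (p B) hpB).lt_or_eq with hlt | heq
  · exact Or.inl hlt
  refine Or.inr ⟨heq, ?_⟩
  have hp : p B = p B' := H.unique hB' _ hpB heq.ge
  have hβ : β B ⊆ B' := H.basis_minimal hB hB' hp.symm
  have hlt := sum_lt_sum_of_exchange r hcard hne (fun x hx y hy => by
    rw [Finset.mem_sdiff] at hx hy
    have hx' := (Finset.mem_union.1 (hsub hx.1)).resolve_left hx.2
    exact (Finset.mem_filter.1 hx').2.2.2 y hy.1 fun hyβ => hy.2 (hβ hyβ))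
  change -(∑ v ∈ B', (r v : ℤ)) < -(∑ v ∈ B, (r v : ℤ))
  exact_mod_cast neg_lt_neg (Int.ofNat_lt.2 hlt)

open Classical in
-- A basis has at most `d` elements, so some element of `G` lies outside it. Deleting the last such
-- element changes neither the lowest point nor the basis.
theorem exists_extension (H : IsNondegenerate K h d p β) {r : V → ℕ} (hr : Function.Injective r)
    {G : Finset V} (hG : IsFace K G) (hcard : G.card = d + 1) :
    ∃ B, B.card = d ∧ IsFace K B ∧ ∃ x ∈ extension K p β r B, insert x B = G := by
  have hne : (G \ β G).Nonempty := by
    rw [Finset.sdiff_nonempty]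
    intro hsub
    have := Finset.card_le_card hsub
    have := H.card_basis hG
    omega
  obtain ⟨x, hx, hmax⟩ := (G \ β G).exists_max_image r hne
  rw [Finset.mem_sdiff] at hx
  have hsub : G.erase x ⊆ G := G.erase_subset x
  have hB := hG.mono hsub
  have hp : p (G.erase x) = p G :=
    H.point_eq hG (Finset.subset_erase.2 ⟨H.basis_subset hG, hx.2⟩) hsub
  refine ⟨G.erase x, by rw [Finset.card_erase_of_mem hx.1]; omega, hB, x, ?_,
    Finset.insert_erase hx.1⟩
  refine Finset.mem_filter.2 ⟨Finset.mem_univ _, Finset.notMem_erase x G, ?_, fun y hy hyβ => ?_⟩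
  · rw [hp]
    exact H.mem hG x hx.1
  · rw [H.basis_eq hG hB hp] at hyβ
    refine lt_of_le_of_ne (hmax y (Finset.mem_sdiff.2 ⟨hsub hy, hyβ⟩)) fun he => ?_
    exact (Finset.mem_erase.1 hy).1 (hr he)

open Classical in
theorem card_faces_le (H : IsNondegenerate K h d p β) {k : ℕ}
    (hk : ∀ G : Finset V, IsFace K G → G.card ≤ k) :
    ((Finset.univ.powersetCard (d + 1)).filter fun G : Finset V => IsFace K G).card ≤
      ∑ j ∈ Finset.range (k - d), (Fintype.card V - 1 - j).choose d := by
  let r : V → ℕ := fun v => Fintype.equivFin V v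
  have hr : Function.Injective r := fun u v he => (Fintype.equivFin V).injective (Fin.ext he)
  let E := extension K p β r
  have hdisjE : ∀ B, Disjoint B (E B) := fun B =>
    Finset.disjoint_right.2 fun x hx => (Finset.mem_filter.1 hx).2.1
  have hface : ∀ B, IsFace K B → IsFace K (B ∪ E B) := fun B hB => ⟨p B, fun v hv => by
    rcases Finset.mem_union.1 hv with hv | hv
    · exact H.mem hB v hv
    · exact (Finset.mem_filter.1 hv).2.2.1⟩
  have hcardE : ∀ B, (B ∪ E B).card = B.card + (E B).card := fun B =>
    Finset.card_union_of_disjoint (hdisjE B)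
  let F := (Finset.univ.powersetCard d).filter fun B : Finset V => IsFace K B
  have hF : ∀ B ∈ F, B.card = d ∧ IsFace K B := fun B hB => by
    simpa [F] using hB
  calc _ ≤ (F.biUnion fun B => (E B).image fun x => insert x B).card := by
        refine Finset.card_le_card fun G hG => ?_
        simp only [Finset.mem_filter, Finset.mem_powersetCard] at hG
        obtain ⟨B, hB, hBf, x, hx, he⟩ := H.exists_extension hr hG.2 hG.1.2
        refine Finset.mem_biUnion.2 ⟨B, ?_, Finset.mem_image.2 ⟨x, hx, he⟩⟩
        simpa [F] using ⟨hB, hBf⟩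
    _ ≤ ∑ B ∈ F, (E B).card :=
        Finset.card_biUnion_le.trans (Finset.sum_le_sum fun B _ => Finset.card_image_le)
    -- Layer-cake decomposition: `B ∪ E B` is a face, so `E B` has at most `k - d` elements.
    _ = ∑ B ∈ F, ∑ j ∈ Finset.range (k - d), if j < (E B).card then 1 else 0 := by
        refine Finset.sum_congr rfl fun B hB => ?_
        have h1 := hk _ (hface B (hF B hB).2)
        rw [hcardE, (hF B hB).1] at h1
        rw [← Finset.card_filter]
        have h2 : (Finset.range (k - d)).filter (fun j => j < (E B).card)
            = Finset.range (E B).card := by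
          ext j
          simp only [Finset.mem_filter, Finset.mem_range]
          omega
        rw [h2, Finset.card_range]
    _ = ∑ j ∈ Finset.range (k - d), (F.filter fun B => j < (E B).card).card := by
        rw [Finset.sum_comm]
        simp only [Finset.card_filter]
    _ ≤ _ := by
        refine Finset.sum_le_sum fun j _ => ?_
        by_cases hemp : (F.filter fun B => j < (E B).card) = ∅
        · simp [hemp]
        obtain ⟨B₀, hB₀⟩ := Finset.nonempty_iff_ne_empty.2 hemp
        -- A nonempty layer makes the truncated subtractions below exact.
        have hn : d + j + 1 ≤ Fintype.card V := by
          have h1 := (B₀ ∪ E B₀).card_le_univ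
          rw [Finset.mem_filter] at hB₀
          rw [hcardE, (hF B₀ hB₀.1).1] at h1
          omega
        have hb : Fintype.card V - 1 - j = d + (Fintype.card V - 1 - j - d) := by omega
        rw [hb]
        refine card_le_choose_of_skew _ (fun B => (B ∪ E B)ᶜ) d _
          (fun B => toLex (h (p B), -(∑ v ∈ B, r v : ℤ))) (fun B hB => ?_) (fun B hB => ?_)
          (fun B hB => ?_) fun B hB B' hB' hne hd => ?_
        · exact (hF B (Finset.mem_filter.1 hB).1).1
        · rw [Finset.mem_filter] at hB
          rw [Finset.card_compl, hcardE, (hF B hB.1).1]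
          omega
        · exact disjoint_compl_right.mono_left Finset.subset_union_left
        · have h1 := hF B (Finset.mem_filter.1 hB).1
          have h2 := hF B' (Finset.mem_filter.1 hB').1
          exact H.skew r h1.2 (h2.1.trans h1.1.symm) hne (disjoint_compl_right_iff.1 hd)

open Classical in
/-- The upper bound theorem for nondegenerate families, in terms of the sets of indices which are
not faces. -/
theorem choose_le_card_nonfaces (H : IsNondegenerate K h d p β) {k : ℕ}
    (hk : ∀ G : Finset V, IsFace K G → G.card ≤ k) (hdk : d ≤ k) (hkn : k ≤ Fintype.card V) :
    (Fintype.card V - k + d).choose (d + 1) ≤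
      ((Finset.univ.powersetCard (d + 1)).filter fun G : Finset V => ¬ IsFace K G).card := by
  have h1 := H.card_faces_le hk
  have h2 := Finset.card_filter_add_card_filter_not (s := Finset.univ.powersetCard (d + 1))
    (fun G : Finset V => IsFace K G)
  rw [Finset.card_powersetCard, Finset.card_univ,
    choose_succ_eq_sum_add (Fintype.card V) d (k - d) (by omega)] at h2
  have h3 : Fintype.card V - (k - d) = Fintype.card V - k + d := by omega
  rw [h3] at h2
  omega

end IsNondegenerate

/-! ### Lowest points, generic thickening and fractional Helly. -/

open Metric Filter Topology

open Classical in
/-- A point of smallest norm of the set `C`. -/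
noncomputable def lowest {E : Type*} [NormedAddCommGroup E] (C : Set E) : E :=
  if h : ∃ x ∈ C, ∀ y ∈ C, ‖x‖ ≤ ‖y‖ then h.choose else 0

section Lowest

variable {E : Type*} [NormedAddCommGroup E]

theorem lowest_spec [ProperSpace E] {C : Set E} (hC : IsClosed C) (hne : C.Nonempty) :
    lowest C ∈ C ∧ ∀ y ∈ C, ‖lowest C‖ ≤ ‖y‖ := by
  have h : ∃ x ∈ C, ∀ y ∈ C, ‖x‖ ≤ ‖y‖ := by
    obtain ⟨x, hx, hd⟩ := hC.exists_infDist_eq_dist hne 0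
    refine ⟨x, hx, fun y hy => ?_⟩
    have := infDist_le_dist_of_mem (x := (0 : E)) hy
    rw [hd, dist_zero_left, dist_zero_left] at this
    exact this
  rw [lowest, dif_pos h]
  exact h.choose_spec

theorem eq_lowest [InnerProductSpace ℝ E] [ProperSpace E] {C : Set E} (hC : IsClosed C)
    (hconv : Convex ℝ C) {x : E} (hx : x ∈ C) (hle : ‖x‖ ≤ ‖lowest C‖) : x = lowest C := by
  obtain ⟨h1, h2⟩ := lowest_spec hC ⟨x, hx⟩
  by_contra hne
  have heq : ‖x‖ = ‖lowest C‖ := le_antisymm hle (h2 x hx)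
  have hlt := (norm_midpoint_lt_iff heq).2 hne
  have hmem : (1 / 2 : ℝ) • (x + lowest C) ∈ C := by
    rw [smul_add]
    exact hconv hx h1 (by norm_num) (by norm_num) (by norm_num)
  have := h2 _ hmem
  linarith

end Lowest

/-- A vector with small positive entries that avoids finitely many graphs of functions of all but
one of the coordinates. -/
theorem exists_generic {V ι : Type*} [Fintype V] [DecidableEq V] [Fintype ι] (c : ι → V)
    (f : ι → (V → ℝ) → ℝ) (hf : ∀ a δ t, f a (Function.update δ (c a) t) = f a δ) {η : ℝ}
    (hη : 0 < η) : ∃ δ : V → ℝ, (∀ v, 0 < δ v ∧ δ v ≤ η) ∧ ∀ a, δ (c a) ≠ f a δ := by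
  classical
  -- On a grid with `N` values per coordinate, each graph contains at most a `1 / N` fraction of the
  -- points, so fewer than `N` graphs cannot cover the grid.
  let N := Fintype.card ι + 1
  let s : Fin N → ℝ := fun j => η * ((j + 1 : ℕ) : ℝ) / N
  have hN : (0 : ℝ) < N := by positivity
  have hs : Function.Injective s := fun i j h => by
    have h1 : ((i + 1 : ℕ) : ℝ) = ((j + 1 : ℕ) : ℝ) := by
      simp only [s] at h
      rw [div_left_inj' hN.ne'] at h
      exact mul_left_cancel₀ hη.ne' h
    have h2 : (i : ℕ) + 1 = j + 1 := by exact_mod_cast h1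
    exact Fin.ext (by omega)
  let bad : ι → Finset (V → Fin N) := fun a =>
    Finset.univ.filter fun g => s (g (c a)) = f a (s ∘ g)
  have hbad : ∀ a, (bad a).card * N ≤ Fintype.card (V → Fin N) := fun a => by
    -- Overwriting coordinate `c a` of a bad point loses nothing: the old value is dictated by `f
    -- a`, which ignores that coordinate.
    have hinj : Set.InjOn (fun q : (V → Fin N) × Fin N => Function.update q.1 (c a) q.2)
        ((bad a ×ˢ (Finset.univ : Finset (Fin N)) : Finset _) : Set ((V → Fin N) × Fin N)) := by
      rintro ⟨g, t⟩ hg ⟨g', t'⟩ hg' he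
      simp only [Finset.coe_product, Set.mem_prod, Finset.mem_coe, bad, Finset.mem_filter] at hg hg'
      simp only at he
      have ht : t = t' := by simpa using congrFun he (c a)
      have hoff : ∀ v, v ≠ c a → g v = g' v := fun v hv => by simpa [hv] using congrFun he v
      have hupd : Function.update (s ∘ g) (c a) 0 = Function.update (s ∘ g') (c a) 0 := by
        funext v
        by_cases hv : v = c a
        · subst hv
          simp
        · simp [hv, hoff v hv]
      have hval : g (c a) = g' (c a) := by
        apply hs
        rw [hg.1.2, hg'.1.2, ← hf a (s ∘ g) 0, ← hf a (s ∘ g') 0, hupd]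
      refine Prod.ext (funext fun v => ?_) ht
      by_cases hv : v = c a
      · exact hv ▸ hval
      · exact hoff v hv
    have := Finset.card_le_card_of_injOn (t := (Finset.univ : Finset (V → Fin N))) _
      (fun _ _ => Finset.mem_univ _) hinj
    simpa using this
  have hlt : (Finset.univ.biUnion bad).card < (Finset.univ : Finset (V → Fin N)).card := by
    have h1 : (Finset.univ.biUnion bad).card * N ≤
        Fintype.card ι * Fintype.card (V → Fin N) := by
      calc _ ≤ (∑ a, (bad a).card) * N := Nat.mul_le_mul_right _ Finset.card_biUnion_le
        _ = ∑ a, (bad a).card * N := Finset.sum_mul _ _ _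
        _ ≤ ∑ _a : ι, Fintype.card (V → Fin N) := Finset.sum_le_sum fun a _ => hbad a
        _ = _ := by simp
    have h2 : 0 < Fintype.card (V → Fin N) := Fintype.card_pos
    rw [Finset.card_univ]
    by_contra! hge
    have h3 := Nat.mul_le_mul_right N hge
    simp only [N] at h1 h3 h2
    nlinarith
  obtain ⟨g, -, hg⟩ := Finset.exists_mem_notMem_of_card_lt_card hlt
  refine ⟨s ∘ g, fun v => ⟨by simp only [Function.comp, s]; positivity, ?_⟩, fun a ha => hg ?_⟩
  · simp only [Function.comp, s]
    rw [div_le_iff₀ hN]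
    have : (((g v : ℕ) + 1 : ℕ) : ℝ) ≤ N := by exact_mod_cast (g v).2
    nlinarith
  · exact Finset.mem_biUnion.2 ⟨a, Finset.mem_univ _, Finset.mem_filter.2 ⟨Finset.mem_univ _, ha⟩⟩

section Thickening

variable {E V : Type*} [NormedAddCommGroup E]

theorem infDist_le_of_mem_cthickening {C : Set E} {δ : ℝ} (hδ : 0 ≤ δ) {x : E}
    (hx : x ∈ cthickening δ C) : infDist x C ≤ δ :=
  ENNReal.toReal_le_of_le_ofReal hδ (mem_cthickening_iff.1 hx)

/-- If `G` is not a face, the sum of the distances to its sets has a positive minimum on a compact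
neighbourhood of one of them; a common point of very thin thickenings would go below it. -/
theorem exists_isFace_of_isFace_cthickening [ProperSpace E] {K : V → Set E}
    (hK : ∀ v, IsCompact (K v)) (hne : ∀ v, (K v).Nonempty) (G : Finset V) :
    ∃ η > 0, ∀ δ : V → ℝ, (∀ v, 0 < δ v ∧ δ v ≤ η) →
      IsFace (fun v => cthickening (δ v) (K v)) G → IsFace K G := by
  by_cases hG : IsFace K G
  · exact ⟨1, one_pos, fun _ _ _ => hG⟩
  obtain ⟨v₀, hv₀⟩ : G.Nonempty := by
    rw [Finset.nonempty_iff_ne_empty]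
    rintro rfl
    exact hG ⟨0, by simp⟩
  let φ : E → ℝ := fun x => ∑ v ∈ G, infDist x (K v)
  have hφ : Continuous φ := continuous_finsetSum _ fun v _ => continuous_infDist_pt (K v)
  obtain ⟨x₀, hx₀, hmin⟩ := ((hK v₀).cthickening (r := 1)).exists_isMinOn
    ((hne v₀).mono (self_subset_cthickening _)) hφ.continuousOn
  have hpos : 0 < φ x₀ := by
    refine lt_of_le_of_ne (Finset.sum_nonneg fun v _ => infDist_nonneg) fun h0 => hG ⟨x₀, ?_⟩
    intro v hv
    have := (Finset.sum_eq_zero_iff_of_nonneg fun v _ => infDist_nonneg).1 h0.symm v hv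
    exact ((hK v).isClosed.mem_iff_infDist_zero (hne v)).2 this
  refine ⟨min 1 (φ x₀ / (G.card + 1)), by positivity, fun δ hδ hface => ?_⟩
  obtain ⟨x, hx⟩ := hface
  have hx1 : x ∈ cthickening 1 (K v₀) :=
    cthickening_mono ((hδ v₀).2.trans (min_le_left _ _)) _ (hx v₀ hv₀)
  have h1 : φ x₀ ≤ φ x := hmin hx1
  have h2 : φ x ≤ ∑ _v ∈ G, φ x₀ / (G.card + 1) := by
    refine Finset.sum_le_sum fun v hv => ?_
    exact (infDist_le_of_mem_cthickening (hδ v).1.le (hx v hv)).trans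
      ((hδ v).2.trans (min_le_right _ _))
  rw [Finset.sum_const, nsmul_eq_mul, mul_div_assoc', le_div_iff₀ (by positivity)] at h2
  nlinarith

open Classical in
-- Helly's theorem is applied to the sets together with the open ball of radius `‖q‖`. This family
-- has no common point, and a small subfamily without one must contain the ball because the other
-- sets share `q`; at most `d` sets then remain, `d` being the dimension.
theorem exists_basis [InnerProductSpace ℝ E] [FiniteDimensional ℝ E] {K : V → Set E}
    (hclosed : ∀ v, IsClosed (K v)) (hconv : ∀ v, Convex ℝ (K v)) {G : Finset V}
    (hG : IsFace K G) :
    ∃ T ⊆ G, T.card ≤ Module.finrank ℝ E ∧ lowest (⋂ v ∈ T, K v) = lowest (⋂ v ∈ G, K v) := by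
  have : ProperSpace E := FiniteDimensional.proper ℝ E
  have hcl : ∀ T : Finset V, IsClosed (⋂ v ∈ T, K v) := fun T =>
    isClosed_biInter fun v _ => hclosed v
  have hcv : ∀ T : Finset V, Convex ℝ (⋂ v ∈ T, K v) := fun T =>
    convex_iInter₂ fun v _ => hconv v
  obtain ⟨h1, h2⟩ := lowest_spec (hcl G) (by simpa [IsFace, Set.Nonempty] using hG)
  set q := lowest (⋂ v ∈ G, K v)
  let F : Option V → Set E := fun o => o.elim (ball 0 ‖q‖) K
  have hnot : ¬ (⋂ o ∈ Finset.insertNone G, F o).Nonempty := by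
    rintro ⟨x, hx⟩
    simp only [Set.mem_iInter] at hx
    have hxb : x ∈ ball (0 : E) ‖q‖ := hx none (by simp)
    have hxG : x ∈ ⋂ v ∈ G, K v := by
      simp only [Set.mem_iInter]
      exact fun v hv => hx (some v) (by simpa using hv)
    rw [mem_ball_zero_iff] at hxb
    exact absurd hxb (not_lt.2 (h2 x hxG))
  have hhelly := mt (Convex.helly_theorem' (𝕜 := ℝ) (F := F) (s := Finset.insertNone G)
    (fun o _ => by cases o with
      | none => exact convex_ball _ _
      | some v => exact hconv v)) hnot
  push Not at hhelly
  obtain ⟨I, hI, hIcard, hIempty⟩ := hhelly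
  have hsub : I.eraseNone ⊆ G := fun v hv => by
    simpa using hI (Finset.mem_eraseNone.1 hv)
  have hqT : q ∈ ⋂ v ∈ I.eraseNone, K v := by
    simp only [Set.mem_iInter] at h1 ⊢
    exact fun v hv => h1 v (hsub hv)
  have hnone : none ∈ I := by
    by_contra hn
    refine Set.eq_empty_iff_forall_notMem.1 hIempty q ?_
    simp only [Set.mem_iInter] at hqT ⊢
    rintro (_ | v) ho
    · exact absurd ho hn
    · exact hqT v (by simpa using ho)
  refine ⟨I.eraseNone, hsub, ?_, ?_⟩
  · have := Finset.card_eraseNone_of_mem hnone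
    omega
  · refine (eq_lowest (hcl _) (hcv _) hqT ?_).symm
    by_contra! hlt
    have hmem := (lowest_spec (hcl I.eraseNone) ⟨q, hqT⟩).1
    refine Set.eq_empty_iff_forall_notMem.1 hIempty (lowest (⋂ v ∈ I.eraseNone, K v)) ?_
    simp only [Set.mem_iInter] at hmem ⊢
    rintro (_ | v) ho
    · exact mem_ball_zero_iff.2 hlt
    · exact hmem v (by simpa using ho)

/-- A set that is needed to determine the lowest point of an intersection has that point on its
boundary. -/
theorem infDist_eq_of_essential [InnerProductSpace ℝ E] [ProperSpace E] [DecidableEq V]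
    {K : V → Set E} (hconv : ∀ v, Convex ℝ (K v)) (hne : ∀ v, (K v).Nonempty) {δ : V → ℝ}
    (hδ : ∀ v, 0 < δ v) {T : Finset V} {i : V} (hi : i ∈ T)
    (hT : IsFace (fun v => cthickening (δ v) (K v)) T)
    (hess : lowest (⋂ v ∈ T.erase i, cthickening (δ v) (K v)) ≠
      lowest (⋂ v ∈ T, cthickening (δ v) (K v))) :
    δ i = infDist (lowest (⋂ v ∈ T, cthickening (δ v) (K v))) (K i) := by
  have hcl : ∀ T : Finset V, IsClosed (⋂ v ∈ T, cthickening (δ v) (K v)) := fun T =>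
    isClosed_biInter fun v _ => isClosed_cthickening
  have hcv : ∀ T : Finset V, Convex ℝ (⋂ v ∈ T, cthickening (δ v) (K v)) := fun T =>
    convex_iInter₂ fun v _ => (hconv v).cthickening _
  obtain ⟨h1, h2⟩ := lowest_spec (hcl T) (by simpa [IsFace, Set.Nonempty] using hT)
  set p := lowest (⋂ v ∈ T, cthickening (δ v) (K v)) with hp
  have hpe : p ∈ ⋂ v ∈ T.erase i, cthickening (δ v) (K v) := by
    simp only [Set.mem_iInter] at h1 ⊢
    exact fun v hv => h1 v (Finset.mem_of_mem_erase hv)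
  obtain ⟨h3, h4⟩ := lowest_spec (hcl (T.erase i)) ⟨p, hpe⟩
  have h5 := eq_lowest (hcl (T.erase i)) (hcv _) hpe
  set q := lowest (⋂ v ∈ T.erase i, cthickening (δ v) (K v))
  have hlt : ‖q‖ < ‖p‖ := by
    by_contra! hge
    exact hess (h5 hge).symm
  by_contra hne'
  have hpi : p ∈ cthickening (δ i) (K i) := by
    simp only [Set.mem_iInter] at h1
    exact h1 i hi
  have hin : p ∈ thickening (δ i) (K i) := by
    rw [mem_thickening_iff_infDist_lt (hne i)]
    exact lt_of_le_of_ne (infDist_le_of_mem_cthickening (hδ i).le hpi) (Ne.symm hne')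
  -- If `p` were interior to the `i`-th set, a short move towards the lower point `q` would stay in
  -- all sets and reduce the norm.
  have hcont : Continuous (AffineMap.lineMap p q : ℝ → E) := AffineMap.lineMap_continuous
  have hev : ∀ᶠ t in 𝓝[>] (0 : ℝ), AffineMap.lineMap p q t ∈ thickening (δ i) (K i) := by
    refine (hcont.continuousAt.eventually_mem ?_).filter_mono nhdsWithin_le_nhds
    rw [AffineMap.lineMap_apply_zero]
    exact isOpen_thickening.mem_nhds hin
  obtain ⟨t, ht, ht0, ht1⟩ := (hev.and (Ioc_mem_nhdsGT one_pos)).exists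
  have hmem : AffineMap.lineMap p q t ∈ ⋂ v ∈ T, cthickening (δ v) (K v) := by
    have hline := (hcv (T.erase i)).lineMap_mem hpe h3 ⟨ht0.le, ht1⟩
    simp only [Set.mem_iInter] at hline ⊢
    intro v hv
    by_cases hvi : v = i
    · subst hvi
      exact thickening_subset_cthickening _ _ ht
    · exact hline v (Finset.mem_erase.2 ⟨hvi, hv⟩)
  have hge := h2 _ hmem
  have hle : ‖(AffineMap.lineMap p q t : E)‖ ≤ (1 - t) * ‖p‖ + t * ‖q‖ := by
    rw [AffineMap.lineMap_apply_module]
    refine (norm_add_le _ _).trans ?_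
    rw [norm_smul, norm_smul, Real.norm_of_nonneg ht0.le, Real.norm_of_nonneg (sub_nonneg.2 ht1)]
  nlinarith

open Classical in
/-- Compact convex sets can be thickened to a nondegenerate family with the same faces. -/
theorem exists_nondegenerate [Fintype V] [InnerProductSpace ℝ E] [FiniteDimensional ℝ E]
    {K : V → Set E} (hconv : ∀ v, Convex ℝ (K v)) (hK : ∀ v, IsCompact (K v))
    (hne : ∀ v, (K v).Nonempty) :
    ∃ K' : V → Set E, (∀ G, IsFace K' G ↔ IsFace K G) ∧
      ∃ p β, IsNondegenerate K' (fun x => ‖x‖) (Module.finrank ℝ E) p β := by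
  have : ProperSpace E := FiniteDimensional.proper ℝ E
  choose η hη hface using exists_isFace_of_isFace_cthickening hK hne
  obtain ⟨G₀, -, hmin⟩ := (Finset.univ : Finset (Finset V)).exists_min_image η ⟨∅, by simp⟩
  -- The excluded coincidence: for `i ∉ T`, the lowest point over `T` lies at distance exactly `δ i`
  -- from `K i`. That distance does not depend on `δ i`.
  obtain ⟨δ, hδ, hgen⟩ := exists_generic (V := V)
    (ι := {a : Finset V × V // a.2 ∉ a.1}) (fun a => a.1.2)
    (fun a δ => infDist (lowest (⋂ v ∈ a.1.1, cthickening (δ v) (K v))) (K a.1.2))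
    (fun a δ t => by
      have : ∀ v ∈ a.1.1, Function.update δ a.1.2 t v = δ v := fun v hv =>
        Function.update_of_ne (ne_of_mem_of_not_mem hv a.2) _ _
      have hI : (⋂ v ∈ a.1.1, cthickening (Function.update δ a.1.2 t v) (K v)) =
          ⋂ v ∈ a.1.1, cthickening (δ v) (K v) :=
        Set.iInter₂_congr fun v hv => by rw [this v hv]
      simp only [hI]) (hη G₀)
  let K' : V → Set E := fun v => cthickening (δ v) (K v)
  let p : Finset V → E := fun G => lowest (⋂ v ∈ G, K' v)
  have hcl : ∀ v, IsClosed (K' v) := fun v => isClosed_cthickening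
  have hcv : ∀ v, Convex ℝ (K' v) := fun v => (hconv v).cthickening _
  have hcl' : ∀ T : Finset V, IsClosed (⋂ v ∈ T, K' v) := fun T =>
    isClosed_biInter fun v _ => hcl v
  have hcv' : ∀ T : Finset V, Convex ℝ (⋂ v ∈ T, K' v) := fun T =>
    convex_iInter₂ fun v _ => hcv v
  have hspec : ∀ {G : Finset V}, IsFace K' G →
      p G ∈ (⋂ v ∈ G, K' v) ∧ ∀ y ∈ (⋂ v ∈ G, K' v), ‖p G‖ ≤ ‖y‖ := fun {G} hG =>
    lowest_spec (hcl' G) (by simpa [IsFace, Set.Nonempty] using hG)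
  have hex : ∀ G : Finset V, ∃ T ⊆ G, p T = p G ∧ ∀ T' ⊆ G, p T' = p G → T.card ≤ T'.card :=
    fun G => by
    obtain ⟨T, hT, hTmin⟩ := (G.powerset.filter fun T => p T = p G).exists_min_image
      Finset.card ⟨G, by simp⟩
    rw [Finset.mem_filter, Finset.mem_powerset] at hT
    exact ⟨T, hT.1, hT.2, fun T' h1 h2 =>
      hTmin T' (Finset.mem_filter.2 ⟨Finset.mem_powerset.2 h1, h2⟩)⟩
  choose β hsub hpt hβmin using hex
  have hbasis : ∀ {G T : Finset V}, IsFace K' G → IsFace K' T → p T = p G → β G ⊆ T := by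
    intro G T hG hT hpTG i hi
    by_contra hiT
    refine hgen ⟨(T, i), hiT⟩ ?_
    -- Minimal cardinality makes `i` essential in `β G`, so `δ i` is the distance from `p G = p T`
    -- to `K i`, although `i ∉ T`; genericity forbids this.
    have hess : p ((β G).erase i) ≠ p (β G) := fun he => by
      have h1 := hβmin G ((β G).erase i) (((β G).erase_subset i).trans (hsub G))
        (he.trans (hpt G))
      rw [Finset.card_erase_of_mem hi] at h1
      have := Finset.card_pos.2 ⟨i, hi⟩
      omega
    have h2 := infDist_eq_of_essential hconv hne (fun v => (hδ v).1) hi (hG.mono (hsub G)) hess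
    change δ i = infDist (p T) (K i)
    rw [hpTG, ← hpt G]
    exact h2
  refine ⟨K', fun G => ⟨fun h => hface G δ (fun v => ⟨(hδ v).1,
    (hδ v).2.trans (hmin G (Finset.mem_univ _))⟩) h, fun h => ?_⟩, p, β, ?_⟩
  · exact h.imp fun x hx v hv => self_subset_cthickening _ (hx v hv)
  · refine ⟨fun {G} hG v hv => ?_, fun {G} hG x hx => ?_, fun {G} hG x hx hle => ?_,
      fun {G} _ => hsub G, fun {G} hG => ?_, fun {G} _ => hpt G, hbasis⟩
    · exact Set.mem_iInter₂.1 (hspec hG).1 v hv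
    · exact (hspec hG).2 x (Set.mem_iInter₂.2 hx)
    · exact eq_lowest (hcl' G) (hcv' G) (Set.mem_iInter₂.2 hx) hle
    · obtain ⟨T, hTG, hTcard, hTp⟩ := exists_basis hcl hcv hG
      exact (hβmin G T hTG hTp).trans hTcard

open Classical in
/-- The optimal fractional Helly theorem, for families of compact convex sets. -/
theorem fractional_helly [Fintype V] [InnerProductSpace ℝ E] [FiniteDimensional ℝ E]
    {K : V → Set E} (hconv : ∀ v, Convex ℝ (K v)) (hK : ∀ v, IsCompact (K v))
    (hne : ∀ v, (K v).Nonempty) {k : ℕ} (hk : ∀ G : Finset V, IsFace K G → G.card ≤ k)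
    (hdk : Module.finrank ℝ E ≤ k) (hkn : k ≤ Fintype.card V) :
    (Fintype.card V - k + Module.finrank ℝ E).choose (Module.finrank ℝ E + 1) ≤
      ((Finset.univ.powersetCard (Module.finrank ℝ E + 1)).filter
        fun G : Finset V => ¬ IsFace K G).card := by
  obtain ⟨K', hK', p, β, H⟩ := exists_nondegenerate hconv hK hne
  have := H.choose_le_card_nonfaces (fun G hG => hk G ((hK' G).1 hG)) hdk hkn
  simpa only [hK'] using this

end Thickening

/-! ### From nonfaces to tuples that do not fit. -/

/-- Each `m`-set has `m!` orderings; tuples with repetitions account for the inequality. -/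
theorem factorial_mul_card_le_card_tuples {V : Type*} [Fintype V] [DecidableEq V] (m : ℕ)
    (Q : Finset V → Prop) [DecidablePred Q] :
    m.factorial * ((Finset.univ.powersetCard m).filter fun G : Finset V => Q G).card ≤
      (Finset.univ.filter fun u : Fin m → V => Q (Finset.univ.image u)).card := by
  let T := Finset.univ.filter fun u : Fin m → V => Q (Finset.univ.image u)
  let N := (Finset.univ.powersetCard m).filter fun G : Finset V => Q G
  have hfib : ∀ G ∈ N, m.factorial ≤ (T.filter fun u => Finset.univ.image u = G).card := by
    intro G hG
    simp only [N, Finset.mem_filter, Finset.mem_powersetCard] at hG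
    have he : Fintype.card (Fin m ≃ G) = m.factorial := by
      have e : Fin m ≃ G := (G.equivFinOfCardEq hG.1.2).symm
      rw [Fintype.card_equiv e, Fintype.card_fin]
    rw [← he, ← Finset.card_univ]
    refine Finset.card_le_card_of_injOn (fun e i => (e i : V)) (fun e _ => ?_)
      fun e _ e' _ h => ?_
    · have him : Finset.univ.image (fun i => (e i : V)) = G := by
        ext v
        simp only [Finset.mem_image, Finset.mem_univ, true_and]
        exact ⟨fun ⟨i, hi⟩ => hi ▸ (e i).2, fun hv => ⟨e.symm ⟨v, hv⟩, by simp⟩⟩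
      simp only [Finset.coe_filter, Set.mem_ofPred_eq, T, Finset.mem_filter, Finset.mem_univ,
        true_and, him]
      exact ⟨hG.2, trivial⟩
    · exact Equiv.ext fun i => Subtype.ext (congrFun h i)
  calc m.factorial * N.card = ∑ _G ∈ N, m.factorial := by simp [mul_comm]
    _ ≤ ∑ G ∈ N, (T.filter fun u => Finset.univ.image u = G).card := Finset.sum_le_sum hfib
    _ ≤ ∑ G : Finset V, (T.filter fun u => Finset.univ.image u = G).card :=
        Finset.sum_le_sum_of_subset (Finset.subset_univ _)
    _ = T.card := (Finset.card_eq_sum_card_fiberwise fun _ _ => Finset.mem_coe.2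
        (Finset.mem_univ _)).symm

variable {d : ℕ}

theorem mem_vadd_iff_of_symmetric (A : ConvexBody (Space d)) (hA : ∀ v, v ∈ A ↔ -v ∈ A)
    (v x : Space d) :
    v ∈ x +ᵥ (A : Set (Space d)) ↔ x ∈ v +ᵥ (A : Set (Space d)) := by
  rw [Set.mem_vadd_set_iff_neg_vadd_mem, Set.mem_vadd_set_iff_neg_vadd_mem, vadd_eq_add,
    vadd_eq_add]
  have h : -v + x = -(-x + v) := by abel
  rw [h]
  exact hA _

open Classical in
/-- If every translate misses an `ε`-fraction of `S`, then at least an `ε ^ (d + 1)`-fraction of the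
`(d + 1)`-tuples of points of `S` do not fit into one translate. -/
theorem pow_le_card_bad_tuples (hd : 1 ≤ d) (A : ConvexBody (Space d))
    (hA : ∀ v, v ∈ A ↔ -v ∈ A) {ε : ℝ} (hε : 0 < ε) (S : Finset (Space d)) [Nonempty S]
    (hfar : ∀ v : Space d, (countInTranslate (A : Set (Space d)) S v : ℝ) ≤ (1 - ε) * S.card) :
    (ε * S.card) ^ (d + 1) ≤ ((Finset.univ.filter fun t : Fin (d + 1) → S =>
      ¬ FitsInTranslate (A : Set (Space d)) {x | ∃ i, (t i : Space d) = x}).card : ℝ) := by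
  -- Each translate is taken `d` times. Since `k₀ ≥ 1`, this secures the requirement `d ≤ k₀ * d` of
  -- fractional Helly; the factor `d ^ (d + 1)` cancels at the end.
  let K : S × Fin d → Set (Space d) := fun a => (a.1 : Space d) +ᵥ (A : Set (Space d))
  let k₀ := ⌊(1 - ε) * S.card⌋₊
  have hcount : ∀ v, countInTranslate (A : Set (Space d)) S v ≤ k₀ := fun v => Nat.le_floor (hfar v)
  obtain ⟨x₀⟩ := ‹Nonempty S›
  have hk₀ : 1 ≤ k₀ := by
    obtain ⟨a, ha⟩ := A.nonempty
    refine le_trans ?_ (hcount ((x₀ : Space d) - a))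
    rw [countInTranslate, Nat.one_le_iff_ne_zero, ← Nat.pos_iff_ne_zero, Finset.card_pos]
    refine ⟨x₀, ?_⟩
    exact Finset.mem_filter.2 ⟨x₀.2, Set.mem_vadd_set.2 ⟨a, ha, by simp⟩⟩
  have hSpos : (0 : ℝ) < S.card :=
    Nat.cast_pos.2 (Finset.card_pos.2 ⟨(x₀ : Space d), x₀.2⟩)
  have hk₀' : (k₀ : ℝ) ≤ (1 - ε) * S.card :=
    Nat.floor_le ((Nat.cast_nonneg _).trans (hfar 0))
  have hk₀S : k₀ ≤ S.card := by
    have : (k₀ : ℝ) ≤ S.card := by nlinarith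
    exact_mod_cast this
  have hcardV : Fintype.card (S × Fin d) = S.card * d := by simp
  have hface : ∀ G : Finset (S × Fin d), IsFace K G ↔
      FitsInTranslate (A : Set (Space d)) {x | ∃ a ∈ G, (a.1 : Space d) = x} := fun G => by
    constructor
    · rintro ⟨v, hv⟩
      refine ⟨v, ?_⟩
      rintro _ ⟨a, ha, rfl⟩
      exact (mem_vadd_iff_of_symmetric A hA _ _).1 (hv a ha)
    · rintro ⟨v, hv⟩
      exact ⟨v, fun a ha => (mem_vadd_iff_of_symmetric A hA _ _).2 (hv ⟨a, ha, rfl⟩)⟩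
  have hk : ∀ G : Finset (S × Fin d), IsFace K G → G.card ≤ k₀ * d := by
    intro G hG
    obtain ⟨v, hv⟩ := (hface G).1 hG
    calc G.card ≤ ((S.filter fun x => x ∈ v +ᵥ (A : Set (Space d))) ×ˢ
          (Finset.univ : Finset (Fin d))).card := by
          refine Finset.card_le_card_of_injOn (fun a => ((a.1 : Space d), a.2)) (fun a ha => ?_)
            fun a _ b _ h => ?_
          · simp only [Finset.coe_product, Set.mem_prod, Finset.mem_coe, Finset.mem_filter]
            exact ⟨⟨a.1.2, hv ⟨a, ha, rfl⟩⟩, Finset.mem_univ _⟩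
          · simp only [Prod.mk.injEq] at h
            exact Prod.ext (Subtype.ext h.1) h.2
      _ = countInTranslate (A : Set (Space d)) S v * d := by
          rw [Finset.card_product, Finset.card_univ, Fintype.card_fin, countInTranslate]
      _ ≤ k₀ * d := Nat.mul_le_mul_right _ (hcount v)
  have hfin : Module.finrank ℝ (Space d) = d := by simp [Space]
  have hhelly := fractional_helly (K := K) (fun a => A.convex.vadd _)
    (fun a => A.isCompact.vadd _) (fun a => A.nonempty.vadd_set) hk
    (by rw [hfin]; nlinarith) (by rw [hcardV]; exact Nat.mul_le_mul_right _ hk₀S)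
  rw [hfin, hcardV, ← Nat.sub_mul] at hhelly
  have htup := factorial_mul_card_le_card_tuples (V := S × Fin d) (d + 1) fun G => ¬ IsFace K G
  -- Fitting depends only on the underlying points, and each tuple of points has `d ^ (d + 1)`
  -- lifts.
  have hproj : (Finset.univ.filter fun u : Fin (d + 1) → S × Fin d =>
        ¬ IsFace K (Finset.univ.image u)).card ≤
      (Finset.univ.filter fun t : Fin (d + 1) → S =>
        ¬ FitsInTranslate (A : Set (Space d)) {x | ∃ i, (t i : Space d) = x}).card
        * d ^ (d + 1) := by
    have hcd : d ^ (d + 1) = (Finset.univ : Finset (Fin (d + 1) → Fin d)).card := by simp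
    rw [hcd, ← Finset.card_product]
    refine Finset.card_le_card_of_injOn (fun u => (fun i => (u i).1, fun i => (u i).2))
      (fun u hu => ?_) fun u _ u' _ h => ?_
    · simp only [Finset.coe_filter, Finset.mem_univ, true_and, Set.mem_ofPred_eq, hface] at hu
      simp only [Finset.coe_product, Set.mem_prod, Finset.mem_coe, Finset.mem_filter,
        Finset.mem_univ, true_and, and_true]
      simpa using hu
    · simp only [Prod.mk.injEq] at h
      exact funext fun i => Prod.ext (congrFun h.1 i) (congrFun h.2 i)
  have hpow : ((S.card - k₀) * d) ^ (d + 1) ≤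
      (d + 1).factorial * ((S.card - k₀) * d + d).choose (d + 1) := by
    have h1 := Nat.ascFactorial_eq_factorial_mul_choose' ((S.card - k₀) * d) (d + 1)
    have h2 : (S.card - k₀) * d + (d + 1) - 1 = (S.card - k₀) * d + d := by omega
    rw [h2] at h1
    rw [← h1]
    exact Nat.pow_succ_le_ascFactorial _ _
  have hall := (hpow.trans (Nat.mul_le_mul_left _ hhelly)).trans (htup.trans hproj)
  rw [mul_pow] at hall
  have hfinal := Nat.le_of_mul_le_mul_right hall (by positivity)
  calc (ε * S.card) ^ (d + 1) ≤ (((S.card - k₀ : ℕ) : ℝ)) ^ (d + 1) := by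
        refine pow_le_pow_left₀ (by positivity) ?_ _
        rw [Nat.cast_sub hk₀S]
        linarith
    _ ≤ _ := by exact_mod_cast hfinal

/-! ### The tester and its execution. -/

/-- The tester. It first computes `ε ^ (d + 1)` in `R 3`. Then, until `ε ^ (d + 1)` times the number
of rounds reaches `2`, it draws `d + 1` points per round and rejects if they do not fit. -/
def tester : Program :=
  -- `R 4` is initially `0`, so `.add 3 0 4` copies `ε`; it later serves as the loop counter. A
  -- `.jumpLe i i l` is an unconditional jump. `R 6` accumulates `ε ^ (d + 1)` once per passed
  -- round, which avoids division.
  [.const 2 1, .const 5 2, .add 3 0 4,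
   .jumpLe 1 4 7, .mul 3 3 0, .add 4 4 2, .jumpLe 4 4 3,
   .jumpLe 5 6 17, .clear, .sub 4 4 4, .sample,
   .jumpLe 1 4 15, .sample, .add 4 4 2, .jumpLe 4 4 11,
   .jumpFit 18, .reject, .accept,
   .add 6 6 3, .jumpLe 6 6 7]

/-- The registers of the tester. -/
def registers (ε : ℝ) (d : ℕ) (p k s : ℝ) : ℕ → ℝ
  | 0 => ε
  | 1 => d
  | 2 => 1
  | 3 => p
  | 4 => k
  | 5 => 2
  | 6 => s
  | _ => 0

section Registers

variable (ε : ℝ) (d : ℕ) (p k s x : ℝ)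

theorem update_registers_three :
    Function.update (registers ε d p k s) 3 x = registers ε d x k s := by
  funext i
  rcases i with _ | _ | _ | _ | _ | _ | _ | i <;> simp [registers]

theorem update_registers_four :
    Function.update (registers ε d p k s) 4 x = registers ε d p x s := by
  funext i
  rcases i with _ | _ | _ | _ | _ | _ | _ | i <;> simp [registers]

theorem update_registers_six :
    Function.update (registers ε d p k s) 6 x = registers ε d p k x := by
  funext i
  rcases i with _ | _ | _ | _ | _ | _ | _ | i <;> simp [registers]

end Registers

/-- The machine gets from one configuration to the other. -/
def Reaches (P : Program) (A : Set (Space d)) {S : Finset (Space d)} (ω : ℕ → S)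
    (c c' : Config d) : Prop :=
  ∃ t : ℕ, (step P A ω)^[t] c = c'

theorem Reaches.trans {P : Program} {A : Set (Space d)} {S : Finset (Space d)} {ω : ℕ → S}
    {c₁ c₂ c₃ : Config d} (h : Reaches P A ω c₁ c₂) (h' : Reaches P A ω c₂ c₃) :
    Reaches P A ω c₁ c₃ := by
  obtain ⟨t, rfl⟩ := h
  obtain ⟨t', rfl⟩ := h'
  exact ⟨t' + t, Function.iterate_add_apply _ _ _ _⟩

theorem Reaches.haltsWith {P : Program} {A : Set (Space d)} {S : Finset (Space d)} {ε : ℝ}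
    {ω : ℕ → S} {c : Config d} {v : Verdict} (h : Reaches P A ω (initial d ε) c)
    (hv : c.verdict = some v) : HaltsWith P A ε ω v c.samples c.time := by
  obtain ⟨t, rfl⟩ := h
  exact ⟨t, hv, rfl, rfl⟩

/-- The points number `n, …, n + k`, the last one first. -/
def draws {S : Finset (Space d)} (ω : ℕ → S) (n : ℕ) : ℕ → List (Space d)
  | 0 => [(ω n : Space d)]
  | k + 1 => (ω (n + k + 1) : Space d) :: draws ω n k

theorem length_draws {S : Finset (Space d)} (ω : ℕ → S) (n k : ℕ) :
    (draws ω n k).length = k + 1 := by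
  induction k with
  | zero => rfl
  | succ k ih => simp [draws, ih]

theorem mem_draws {S : Finset (Space d)} (ω : ℕ → S) (n k : ℕ) (x : Space d) :
    x ∈ draws ω n k ↔ ∃ i : Fin (k + 1), (ω (n + i) : Space d) = x := by
  induction k with
  | zero => simp [draws, eq_comm]
  | succ k ih =>
    rw [draws, List.mem_cons, ih, Fin.exists_iff_castSucc (n := k + 1)]
    simp [eq_comm, add_assoc]

section Run

variable (A : Set (Space d)) {S : Finset (Space d)} (ω : ℕ → S) (ε p k s : ℝ)
  (w : List (Space d)) (n t : ℕ)

theorem reaches_power_loop :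
    Reaches tester A ω (initial d ε) ⟨3, registers ε d ε 0 0, [], none, 0, 3⟩ := by
  refine ⟨3, ?_⟩
  simp only [Function.iterate_succ_apply, Function.iterate_zero, id, step, initial, tester]
  simp only [List.getElem?_cons_zero, List.getElem?_cons_succ, Config.mk.injEq, and_true, true_and,
    zero_add]
  funext i
  rcases i with _ | _ | _ | _ | _ | _ | _ | i <;> simp [registers]

theorem power_loop_step (hk : k < d) :
    Reaches tester A ω ⟨3, registers ε d p k s, w, none, n, t⟩
      ⟨3, registers ε d (p * ε) (k + 1) s, w, none, n, t + 4⟩ := by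
  refine ⟨4, ?_⟩
  have h1 : ¬ registers ε d p k s 1 ≤ registers ε d p k s 4 := by simpa [registers] using hk
  simp [Function.iterate_succ_apply, step, tester, update_registers_three, update_registers_four,
    h1]
  simp [registers]

theorem reaches_round_start :
    Reaches tester A ω (initial d ε)
      ⟨7, registers ε d (ε ^ (d + 1)) d 0, [], none, 0, 4 + 4 * d⟩ := by
  have hloop : ∀ k ≤ d, Reaches tester A ω (initial d ε)
      ⟨3, registers ε d (ε ^ (k + 1)) k 0, [], none, 0, 3 + 4 * k⟩ := by
    intro k
    induction k with
    | zero => simpa using reaches_power_loop A ω ε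
    | succ k ih =>
      intro hk
      have := (ih (by omega)).trans
        (power_loop_step A ω ε (ε ^ (k + 1)) k 0 [] 0 _ (by exact_mod_cast hk))
      rw [← pow_succ] at this
      exact_mod_cast this
  refine (hloop d le_rfl).trans ⟨1, ?_⟩
  simp [step, tester, registers]
  ring

theorem round_start (hs : s < 2) :
    Reaches tester A ω ⟨7, registers ε d p k s, w, none, n, t⟩
      ⟨11, registers ε d p 0 s, draws ω n 0, none, n + 1, t + 4⟩ := by
  refine ⟨4, ?_⟩
  have h5 : ¬ registers ε d p k s 5 ≤ registers ε d p k s 6 := by simpa [registers] using hs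
  simp [Function.iterate_succ_apply, step, tester, update_registers_four, h5, draws]

theorem draw_step (hk : k < d) :
    Reaches tester A ω ⟨11, registers ε d p k s, w, none, n, t⟩
      ⟨11, registers ε d p (k + 1) s, (ω n : Space d) :: w, none, n + 1, t + 4⟩ := by
  refine ⟨4, ?_⟩
  have h1 : ¬ registers ε d p k s 1 ≤ registers ε d p k s 4 := by simpa [registers] using hk
  simp [Function.iterate_succ_apply, step, tester, update_registers_four, h1]
  simp [registers]

theorem reaches_test (hs : s < 2) :
    Reaches tester A ω ⟨7, registers ε d p k s, w, none, n, t⟩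
      ⟨15, registers ε d p d s, draws ω n d, none, n + (d + 1), t + (5 + 4 * d)⟩ := by
  have hloop : ∀ j ≤ d, Reaches tester A ω ⟨7, registers ε d p k s, w, none, n, t⟩
      ⟨11, registers ε d p j s, draws ω n j, none, n + j + 1, t + 4 + 4 * j⟩ := by
    intro j
    induction j with
    | zero => simpa using round_start A ω ε p k s w n t hs
    | succ j ih =>
      intro hj
      have := (ih (by omega)).trans
        (draw_step A ω ε p j s (draws ω n j) (n + j + 1) _ (by exact_mod_cast hj))
      exact_mod_cast this
  refine (hloop d le_rfl).trans ⟨1, ?_⟩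
  simp [step, tester, registers]
  omega

/-- The `d + 1` points drawn from number `n` on fit into one translate of `A`. -/
def FitsFrom (A : Set (Space d)) {S : Finset (Space d)} (ω : ℕ → S) (n : ℕ) : Prop :=
  FitsInTranslate A {x | ∃ i : Fin (d + 1), (ω (n + i) : Space d) = x}

theorem fitsInTranslate_draws_iff :
    FitsInTranslate A {x | x ∈ draws ω n d} ↔ FitsFrom A ω n := by
  simp only [mem_draws]
  rfl

theorem reaches_next_round (hs : s < 2) (hfit : FitsFrom A ω n) :
    Reaches tester A ω ⟨7, registers ε d p k s, w, none, n, t⟩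
      ⟨7, registers ε d p d (s + p), draws ω n d, none, n + (d + 1), t + (9 + 5 * d)⟩ := by
  refine (reaches_test A ω ε p k s w n t hs).trans ⟨3, ?_⟩
  rw [← fitsInTranslate_draws_iff] at hfit
  simp [Function.iterate_succ_apply, step, tester, update_registers_six, hfit, length_draws]
  refine ⟨by simp [registers], by omega⟩

theorem reaches_reject (hs : s < 2) (hfit : ¬ FitsFrom A ω n) :
    Reaches tester A ω ⟨7, registers ε d p k s, w, none, n, t⟩
      ⟨16, registers ε d p d s, draws ω n d, some .reject, n + (d + 1), t + (8 + 5 * d)⟩ := by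
  refine (reaches_test A ω ε p k s w n t hs).trans ⟨2, ?_⟩
  rw [← fitsInTranslate_draws_iff] at hfit
  simp [Function.iterate_succ_apply, step, tester, hfit, length_draws]
  omega

theorem reaches_accept (hs : 2 ≤ s) :
    Reaches tester A ω ⟨7, registers ε d p k s, w, none, n, t⟩
      ⟨17, registers ε d p k s, w, some .accept, n, t + 2⟩ := by
  refine ⟨2, ?_⟩
  have h5 : registers ε d p k s 5 ≤ registers ε d p k s 6 := by simpa [registers] using hs
  simp [Function.iterate_succ_apply, step, tester, h5]

theorem reaches_round (j : ℕ)
    (h : ∀ i < j, i * ε ^ (d + 1) < 2 ∧ FitsFrom A ω (i * (d + 1))) :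
    ∃ w, Reaches tester A ω (initial d ε)
      ⟨7, registers ε d (ε ^ (d + 1)) d (j * ε ^ (d + 1)), w, none, j * (d + 1),
        4 + 4 * d + j * (9 + 5 * d)⟩ := by
  induction j with
  | zero => exact ⟨[], by simpa using reaches_round_start A ω ε⟩
  | succ j ih =>
    obtain ⟨w, hw⟩ := ih fun i hi => h i (by omega)
    obtain ⟨h1, h2⟩ := h j (by omega)
    refine ⟨draws ω (j * (d + 1)) d, hw.trans ?_⟩
    convert reaches_next_round A ω ε _ _ _ w _ _ h1 h2 using 2
    · push_cast
      ring_nf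
    · ring
    · ring

/-- The number of rounds. -/
noncomputable def rounds (d : ℕ) (ε : ℝ) : ℕ := ⌈2 / ε ^ (d + 1)⌉₊

variable {ε}

theorem haltsWith_accept (hε : 0 < ε) (h : ∀ i < rounds d ε, FitsFrom A ω (i * (d + 1))) :
    HaltsWith tester A ε ω .accept (rounds d ε * (d + 1))
      (4 + 4 * d + rounds d ε * (9 + 5 * d) + 2) := by
  have hp : 0 < ε ^ (d + 1) := by positivity
  obtain ⟨w, hw⟩ := reaches_round A ω ε (rounds d ε) fun i hi =>
    ⟨(lt_div_iff₀ hp).1 (Nat.lt_ceil.1 hi), h i hi⟩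
  exact (hw.trans (reaches_accept A ω ε _ _ _ w _ _
    ((div_le_iff₀ hp).1 (Nat.le_ceil _)))).haltsWith rfl

theorem exists_haltsWith_reject (hε : 0 < ε)
    (h : ∃ i < rounds d ε, ¬ FitsFrom A ω (i * (d + 1))) :
    ∃ j < rounds d ε, HaltsWith tester A ε ω .reject (j * (d + 1) + (d + 1))
      (4 + 4 * d + j * (9 + 5 * d) + (8 + 5 * d)) := by
  classical
  have hp : 0 < ε ^ (d + 1) := by positivity
  have hlt : ∀ i < rounds d ε, i * ε ^ (d + 1) < 2 := fun i hi =>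
    (lt_div_iff₀ hp).1 (Nat.lt_ceil.1 hi)
  obtain ⟨h1, h2⟩ := Nat.find_spec h
  obtain ⟨w, hw⟩ := reaches_round A ω ε (Nat.find h) fun i hi =>
    ⟨hlt i (hi.trans h1), by
      by_contra hn
      exact Nat.find_min h hi ⟨hi.trans h1, hn⟩⟩
  exact ⟨_, h1, (hw.trans (reaches_reject A ω ε _ _ _ w _ _ (hlt _ h1) h2)).haltsWith rfl⟩

theorem rounds_mul_le (hε : 0 < ε) (hε1 : ε ≤ 1) : rounds d ε * ε ^ (d + 1) ≤ 3 := by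
  have hp : 0 < ε ^ (d + 1) := by positivity
  have hp1 : ε ^ (d + 1) ≤ 1 := pow_le_one₀ hε.le hε1
  have := (Nat.ceil_lt_add_one (a := 2 / ε ^ (d + 1)) (by positivity)).le
  calc (rounds d ε : ℝ) * ε ^ (d + 1) ≤ (2 / ε ^ (d + 1) + 1) * ε ^ (d + 1) := by
        exact mul_le_mul_of_nonneg_right this hp.le
    _ = 2 + ε ^ (d + 1) := by field_simp
    _ ≤ 3 := by linarith

theorem exists_haltsWith_le (hd : 1 ≤ d) (hε : 0 < ε) (hε1 : ε ≤ 1) :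
    ∃ (v : Verdict) (q T : ℕ), HaltsWith tester A ε ω v q T ∧
      (q : ℝ) ≤ 52 * (d / ε ^ (d + 1)) ∧ (T : ℝ) ≤ 52 * (d / ε ^ (d + 1)) := by
  have hp : 0 < ε ^ (d + 1) := by positivity
  have hp1 : ε ^ (d + 1) ≤ 1 := pow_le_one₀ hε.le hε1
  have hN := rounds_mul_le (d := d) hε hε1
  have hbound : ∀ q T : ℕ, q ≤ rounds d ε * (d + 1) →
      T ≤ 4 + 4 * d + rounds d ε * (9 + 5 * d) + 2 →
      (q : ℝ) ≤ 52 * (d / ε ^ (d + 1)) ∧ (T : ℝ) ≤ 52 * (d / ε ^ (d + 1)) := by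
    intro q T hq hT
    have hd' : (1 : ℝ) ≤ d := by exact_mod_cast hd
    have hq' : q ≤ rounds d ε * (2 * d) := hq.trans (Nat.mul_le_mul_left _ (by omega))
    -- The constant is `52 = 10 + 3 * 14`, using `rounds d ε * ε ^ (d + 1) ≤ 3` and `ε ^ (d + 1) ≤
    -- 1`.
    have hT' : T ≤ 10 * d + rounds d ε * (14 * d) := hT.trans (by
      have : rounds d ε * (9 + 5 * d) ≤ rounds d ε * (14 * d) := Nat.mul_le_mul_left _ (by omega)
      omega)
    have hqr : (q : ℝ) ≤ rounds d ε * (2 * d) := by exact_mod_cast hq'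
    have hTr : (T : ℝ) ≤ 10 * d + rounds d ε * (14 * d) := by exact_mod_cast hT'
    have hNd := mul_le_mul_of_nonneg_right hN (Nat.cast_nonneg (α := ℝ) d)
    rw [mul_div_assoc', le_div_iff₀ hp, le_div_iff₀ hp]
    constructor
    · have := mul_le_mul_of_nonneg_right hqr hp.le
      nlinarith
    · have := mul_le_mul_of_nonneg_right hTr hp.le
      have := mul_le_mul_of_nonneg_left hp1 (Nat.cast_nonneg (α := ℝ) d)
      nlinarith
  by_cases h : ∀ i < rounds d ε, FitsFrom A ω (i * (d + 1))
  · exact ⟨_, _, _, haltsWith_accept A ω hε h, hbound _ _ le_rfl le_rfl⟩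
  · push Not at h
    obtain ⟨j, hj, hrej⟩ := exists_haltsWith_reject A ω hε h
    refine ⟨_, _, _, hrej, hbound _ _ ?_ ?_⟩
    · have := Nat.mul_le_mul_right (d + 1) hj
      rw [Nat.succ_mul] at this
      exact this
    · have := Nat.mul_le_mul_right (9 + 5 * d) hj
      rw [Nat.succ_mul] at this
      omega

theorem answers_accept_of_fitsInTranslate (hε : 0 < ε)
    (h : FitsInTranslate A (S : Set (Space d))) : Answers tester A ε ω .accept := by
  refine ⟨_, _, haltsWith_accept A ω hε fun i _ => ?_⟩
  obtain ⟨v, hv⟩ := h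
  refine ⟨v, ?_⟩
  rintro _ ⟨j, rfl⟩
  exact hv (ω _).2

end Run

/-! ### Independence of the rounds and the rejection probability. -/

open MeasureTheory

instance (S : Finset (Space d)) [Nonempty S] : IsProbabilityMeasure (sampleLaw S) := by
  unfold sampleLaw
  infer_instance

theorem measurableSet_preimage_reindex {S : Finset (Space d)} {κ : Type*} [Fintype κ] (σ : κ → ℕ)
    (Z : Set (κ → S)) : MeasurableSet {ω : ℕ → S | (fun i => ω (σ i)) ∈ Z} := by
  have hm : Measurable fun (ω : ℕ → S) (i : κ) => ω (σ i) := by fun_prop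
  exact hm Z.toFinite.measurableSet

theorem sampleLaw_singleton (S : Finset (Space d)) [Nonempty S] {κ : Type*} [Fintype κ] {σ : κ → ℕ}
    (hσ : Function.Injective σ) (e : κ → S) :
    (sampleLaw S).real {ω | (fun i => ω (σ i)) = e} = ((S.card : ℝ) ^ Fintype.card κ)⁻¹ := by
  classical
  obtain ⟨x₀⟩ := ‹Nonempty S›
  -- The event is a box over the range of `σ`; the filler `x₀` off the range is irrelevant.
  have hset : {ω : ℕ → S | (fun i => ω (σ i)) = e} =
      Set.pi (Finset.univ.map ⟨σ, hσ⟩ : Finset ℕ)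
        fun n => {Function.extend σ e (fun _ => x₀) n} := by
    ext ω
    simp [funext_iff, Set.mem_pi, hσ.extend_apply]
  rw [hset, sampleLaw, Measure.real, Measure.infinitePi_pi _ fun _ _ => measurableSet_singleton _]
  simp

theorem sampleLaw_reindex (S : Finset (Space d)) [Nonempty S] {κ : Type*} [Fintype κ] {σ : κ → ℕ}
    (hσ : Function.Injective σ) (Z : Finset (κ → S)) :
    (sampleLaw S).real {ω | (fun i => ω (σ i)) ∈ Z} = Z.card / (S.card : ℝ) ^ Fintype.card κ := by
  have hset : {ω : ℕ → S | (fun i => ω (σ i)) ∈ Z} =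
      ⋃ e ∈ Z, {ω | (fun i => ω (σ i)) = e} := by
    ext ω
    simp
  rw [hset, measureReal_biUnion_finset]
  · simp [sampleLaw_singleton S hσ, div_eq_mul_inv]
  · intro e _ e' _ hne
    exact Set.disjoint_left.2 fun ω h h' => hne (h.symm.trans h')
  · exact fun e _ => measurableSet_preimage_reindex σ {e}

/-- Blocks of consecutive random points are independent. -/
theorem sampleLaw_blocks (S : Finset (Space d)) [Nonempty S] (N m : ℕ)
    (Z : Finset (Fin m → S)) :
    (sampleLaw S).real {ω | ∀ j : Fin N, (fun i : Fin m => ω (j * m + i)) ∈ Z} =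
      (Z.card / (S.card : ℝ) ^ m) ^ N := by
  classical
  -- This numbering lays the blocks end to end: `(j, i)` goes to `j * m + i`.
  let σ : Fin N × Fin m → ℕ := fun a => finProdFinEquiv a
  have hσ : Function.Injective σ := Fin.val_injective.comp finProdFinEquiv.injective
  let Y : Finset (Fin N × Fin m → S) := Finset.univ.filter fun e => ∀ j, (fun i => e (j, i)) ∈ Z
  have hY : Y.card = Z.card ^ N := by
    have : Y.card = (Fintype.piFinset fun _ : Fin N => Z).card := by
      refine Finset.card_equiv (Equiv.curry _ _ _) fun e => ?_
      simp only [Y, Finset.mem_filter, Finset.mem_univ, true_and, Fintype.mem_piFinset]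
      rfl
    simp [this]
  have hset : {ω : ℕ → S | ∀ j : Fin N, (fun i : Fin m => ω (j * m + i)) ∈ Z} =
      {ω | (fun a => ω (σ a)) ∈ Y} := by
    ext ω
    have : ∀ (j : Fin N) (i : Fin m), σ (j, i) = j * m + i := fun j i => by
      simp [σ, finProdFinEquiv, add_comm, mul_comm]
    simp [Y, this]
  rw [hset, sampleLaw_reindex S hσ, hY, div_pow, ← pow_mul]
  simp [mul_comm]

/-- The tester rejects inputs that are far from fitting with probability at least `2 / 3`. -/
theorem two_thirds_le_reject (hd : 1 ≤ d) (A : ConvexBody (Space d))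
    (hA : ∀ v, v ∈ A ↔ -v ∈ A) {ε : ℝ} (hε : 0 < ε) (S : Finset (Space d)) [Nonempty S]
    (hfar : ∀ v : Space d, (countInTranslate (A : Set (Space d)) S v : ℝ) ≤ (1 - ε) * S.card) :
    2 / 3 ≤ (sampleLaw S).real {ω | Answers tester (A : Set (Space d)) ε ω .reject} := by
  classical
  let Z : Finset (Fin (d + 1) → S) := Finset.univ.filter fun t =>
    FitsInTranslate (A : Set (Space d)) {x | ∃ i, (t i : Space d) = x}
  let N := rounds d ε
  let G : Set (ℕ → S) := {ω | ∀ j : Fin N, (fun i : Fin (d + 1) => ω (j * (d + 1) + i)) ∈ Z}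
  have hcard : (0 : ℝ) < S.card := by
    obtain ⟨x⟩ := ‹Nonempty S›
    exact Nat.cast_pos.2 (Finset.card_pos.2 ⟨(x : Space d), x.2⟩)
  have hbad := pow_le_card_bad_tuples hd A hA hε S hfar
  have hsum := Finset.card_filter_add_card_filter_not (s := Finset.univ)
    (fun t : Fin (d + 1) → S => FitsInTranslate (A : Set (Space d)) {x | ∃ i, (t i : Space d) = x})
  have hsum' : (Z.card : ℝ) + ((Finset.univ.filter fun t : Fin (d + 1) → S =>
      ¬ FitsInTranslate (A : Set (Space d)) {x | ∃ i, (t i : Space d) = x}).card : ℝ)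
      = (S.card : ℝ) ^ (d + 1) := by
    have h1 : (Finset.univ : Finset (Fin (d + 1) → S)).card = S.card ^ (d + 1) := by simp
    rw [h1] at hsum
    exact_mod_cast hsum
  have hZ : Z.card / (S.card : ℝ) ^ (d + 1) ≤ Real.exp (-ε ^ (d + 1)) := by
    refine le_trans ?_ (Real.one_sub_le_exp_neg _)
    rw [div_le_iff₀ (by positivity), sub_mul, one_mul, ← mul_pow]
    linarith
  have hp : 0 < ε ^ (d + 1) := by positivity
  have hN : 2 ≤ N * ε ^ (d + 1) := (div_le_iff₀ hp).1 (Nat.le_ceil _)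
  have hG : (sampleLaw S).real G ≤ 1 / 3 := by
    calc (sampleLaw S).real G = (Z.card / (S.card : ℝ) ^ (d + 1)) ^ N := sampleLaw_blocks S N _ Z
      _ ≤ Real.exp (-ε ^ (d + 1)) ^ N := pow_le_pow_left₀ (by positivity) hZ _
      _ = Real.exp (-(N * ε ^ (d + 1))) := by
          rw [← Real.exp_nat_mul]
          ring_nf
      _ ≤ 1 / 3 := by
          rw [Real.exp_neg, ← one_div]
          refine one_div_le_one_div_of_le (by norm_num) ?_
          -- The exponent is at least `2`, so its exponential is at least `3`.
          have := Real.add_one_le_exp (N * ε ^ (d + 1))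
          linarith
  have hGm : MeasurableSet G := by
    have : G = ⋂ j : Fin N,
        {ω : ℕ → S | (fun i : Fin (d + 1) => ω (j * (d + 1) + i)) ∈ (Z : Set (Fin (d + 1) → S))} := by
      ext ω
      simp [G]
    rw [this]
    exact MeasurableSet.iInter fun j =>
      measurableSet_preimage_reindex (fun i : Fin (d + 1) => (j : ℕ) * (d + 1) + i) _
  -- Only `G` has to be measurable; monotonicity passes the bound to the rejection event.
  have hsub : Gᶜ ⊆ {ω | Answers tester (A : Set (Space d)) ε ω .reject} := by
    intro ω hω
    simp only [G, Set.mem_compl_iff, Set.mem_ofPred_eq, not_forall] at hω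
    obtain ⟨j, hj⟩ := hω
    obtain ⟨_, _, h⟩ := exists_haltsWith_reject (A : Set (Space d)) ω hε
      ⟨j, j.2, fun hfit => hj (by simpa [Z, FitsFrom] using hfit)⟩
    exact ⟨_, _, h⟩
  calc (2 / 3 : ℝ) ≤ 1 - (sampleLaw S).real G := by linarith
    _ = (sampleLaw S).real Gᶜ := (probReal_compl_eq_one_sub hGm).symm
    _ ≤ _ := measureReal_mono hsub

end ClusterTesting

theorem theorem1 :
    ∃ (C : ℝ) (P : ClusterTesting.Program),
      ∀ (d : ℕ), 1 ≤ d →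
      ∀ (A : ConvexBody (ClusterTesting.Space d)), (∀ v, v ∈ A ↔ -v ∈ A) →
      ∀ (ε : ℝ), 0 < ε → ε ≤ 1 →
      ∀ (S : Finset (ClusterTesting.Space d)) [Nonempty S],
        (∀ ω : ℕ → S, ∃ (v : ClusterTesting.Verdict) (q T : ℕ),
          ClusterTesting.HaltsWith P (A : Set (ClusterTesting.Space d)) ε ω v q T ∧
          (q : ℝ) ≤ C * (d / ε ^ (d + 1)) ∧
          (T : ℝ) ≤ C * (d / ε ^ (d + 1))) ∧
        (ClusterTesting.FitsInTranslate (A : Set (ClusterTesting.Space d))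
            (S : Set (ClusterTesting.Space d)) →
          ∀ ω : ℕ → S,
            ClusterTesting.Answers P (A : Set (ClusterTesting.Space d)) ε ω .accept) ∧
        ((∀ v : ClusterTesting.Space d,
            (ClusterTesting.countInTranslate (A : Set (ClusterTesting.Space d)) S v : ℝ)
              ≤ (1 - ε) * S.card) →
          2 / 3 ≤ (ClusterTesting.sampleLaw S).real
            {ω | ClusterTesting.Answers P (A : Set (ClusterTesting.Space d)) ε ω .reject}) := by
  refine ⟨52, ClusterTesting.tester, fun d hd A hA ε hε hε1 S _ => ⟨fun ω => ?_, fun h ω => ?_, ?_⟩⟩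
  · exact ClusterTesting.exists_haltsWith_le A ω hd hε hε1
  · exact ClusterTesting.answers_accept_of_fitsInTranslate A ω hε h
  · exact ClusterTesting.two_thirds_le_reject hd A hA hε S
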